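/- Let $q>0$, $q\neq 1$ be fixed. For $x>0$ let $$\Gamma_q(x)=\begin{cases}(1-q)^{1-x}\displaystyle\prod_{k=0}^{\infty}\frac{1-q^{k+1}}{1-q^{k+x}}, & 0<q<1,\\[2mm] (q-1)^{1-x}q^{\frac12 x(x-1)}\displaystyle\prod_{k=0}^{\infty}\frac{1-q^{-(k+1)}}{1-q^{-(k+x)}}, & q>1,\end{cases}$$ let $\psi_q=\Gamma_q'/\Gamma_q$ be its logarithmic derivative, and let $\psi_q^{(m)}$ denote the $m$-th derivative of $\psi_q$. Let $r\ge m\ge n\ge s$ be positive integers with $r+s=m+n$, and put $$\alpha_{r,m,n,s}=\frac{(m-1)!\,(n-1)!}{(r-1)!\,(s-1)!}.$$ Suppose that one of the following holds: (i) $0<q<1$ and $s=1$; (ii) $s=2$; (iii) $s=3$ and $n=4$. Then the function $$f(x)=(-1)^{m+n}\psi_q^{(m)}(x)\,\psi_q^{(n)}(x)-\alpha_{r,m,n,s}\,(-1)^{r+s}\psi_q^{(r)}(x)\,\psi_q^{(s)}(x)$$ is completely monotonic on $(0,\infty)$, i.e. it has derivatives of all orders there and $(-1)^k f^{(k)}(x)\ge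 0$ for all $x>0$ and all integers $k\ge 0$. -/

import Mathlib

open Set
open scoped ContDiff Nat

noncomputable section

/-- The `q`-gamma function `Γ_q(x)`, for `q > 0`, `q ≠ 1` and `x > 0` (real powers throughout). -/
def qGamma (q x : ℝ) : ℝ :=
  if q < 1 then
    (1 - q) ^ (1 - x) * ∏' n : ℕ, (1 - q ^ ((n : ℝ) + 1)) / (1 - q ^ ((n : ℝ) + x))
  else
    (q - 1) ^ (1 - x) * q ^ (1 / 2 * x * (x - 1)) *
      ∏' n : ℕ, (1 - q ^ (-((n : ℝ) + 1))) / (1 - q ^ (-((n : ℝ) + x)))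

/-- The `q`-digamma function `ψ_q = Γ_q' / Γ_q`. -/
def qDigamma (q : ℝ) : ℝ → ℝ := logDeriv (qGamma q)

/-- The `m`-th derivative `ψ_q^{(m)}`, for `m ≥ 1` a `q`-polygamma function. -/
def qPolygamma (q : ℝ) (m : ℕ) : ℝ → ℝ := iteratedDeriv m (qDigamma q)

/-- `f` is completely monotonic on `s` (meant for an open interval `s`): it has derivatives of all
orders on `s`, and `(-1)^k f^{(k)}(x) ≥ 0` for all `k ≥ 0` and `x ∈ s`. -/
def CompletelyMonotonicOn (f : ℝ → ℝ) (s : Set ℝ) : Prop :=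
  ContDiffOn ℝ ∞ f s ∧ ∀ k : ℕ, ∀ x ∈ s, 0 ≤ (-1) ^ k * iteratedDerivWithin k f s x

/-- `α_{r,m,n,s} = (m-1)! (n-1)! / ((r-1)! (s-1)!)`, for positive integers `r, m, n, s`. -/
def alphaCoeff (r m n s : ℕ) : ℝ :=
  ((m - 1)! * (n - 1)! : ℝ) / ((r - 1)! * (s - 1)! : ℝ)

end

/-!
Let `p = q` for `q < 1` and `p = q⁻¹` for `q > 1`. Expanding the logarithms in the product for `Γ_q`
shows that `log Γ_q` is a polynomial of degree at most two (at most one for `q < 1`) plus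
`∑_j p ^ (j x) / (j (1 - p ^ j))`, so that
`ψ_q^{(m)}(x) = (log p) ^ (m + 1) ∑_j j ^ m p ^ (j x) / (1 - p ^ j)`, with an extra `log q` when
`q > 1` and `m = 1` (`exists_qPolygamma_eq`). By the Cauchy product the function in question is
`∑_N c_N p ^ (N x)`, where, up to a positive factor,
`c_N = ∑_{i + j = N} β_i β_j (φ_M(i) φ_K(j) - φ_R(i) φ_S(j))`
with `β_j = j / (1 - p ^ j)`, `φ_M(i) = i ^ M / M!` and `(R, M, K, S) = (r, m, n, s) - (1, 1, 1, 1)`.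
It is therefore enough that `c_N ≥ 0` for every `N`.

The sequence `β` is log-concave by the inequality of the arithmetic and geometric means, so
`β_i β_j` increases as `i` and `j` approach each other, while the bracket, symmetrised in `i` and
`j`, changes sign at most once, from negative to positive. By Chebyshev's sum inequality the weights
`β_i β_j` can be dropped (`sum_qWeight_mul_nonneg`).

What remains is that `A_R A_S ≤ A_M A_K` coefficientwise for `A_M(z) = ∑_{i ≥ 1} φ_M(i) z ^ i`. Such
an inequality may be checked after multiplication by a power of `1 - z`, because `1 / (1 - z)` has
nonnegative coefficients. For `S = 1` the factor `(1 - z) ^ 2` turns `A_R A_1` into `z A_R`, whose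
coefficients `n ^ R / R!` are beta integrals; Chebyshev's integral inequality on each unit interval
bounds them by the coefficients of `((1 - z) A_M) ((1 - z) A_K)` (`coeff_mul_one_le`). For `S = 0`
one more step `A_{L+1} A_0 ≤ A_L A_1` is needed, which is Bernoulli's inequality
(`coeff_mul_zero_le`). For `S = 2`, `K = 3` the factor `(1 - z) ^ 4` leaves the statement that
Simpson's rule overestimates the integral of `φ_M` (`coeff_mul_two_le`).
-/

/-! ### Generating functions of divided powers -/

/-- The divided power `i ^ M / M!` as a sequence on the positive integers, extended by `0` at
`i = 0` for every `M`, including `M = 0`: convolutions of such sequences run over `i, j ≥ 1`. -/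
noncomputable def dividedPow (M i : ℕ) : ℝ := if i = 0 then 0 else (i : ℝ) ^ M / M !

/-- The generating function `∑_{i ≥ 1} (i ^ M / M!) z ^ i`. -/
noncomputable def dividedPowSeries (M : ℕ) : PowerSeries ℝ := PowerSeries.mk (dividedPow M)

@[simp]
theorem dividedPow_zero_right (M : ℕ) : dividedPow M 0 = 0 := by simp [dividedPow]

theorem dividedPow_succ (M i : ℕ) : dividedPow M (i + 1) = ((i : ℝ) + 1) ^ M / M ! := by
  simp [dividedPow]

theorem dividedPow_succ_left (M i : ℕ) :
    dividedPow (M + 1) i = (i : ℝ) ^ (M + 1) / (M + 1)! := by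
  rcases i with _ | i <;> simp [dividedPow]

@[simp]
theorem coeff_dividedPowSeries (M n : ℕ) :
    PowerSeries.coeff n (dividedPowSeries M) = dividedPow M n := by
  simp [dividedPowSeries]

@[simp]
theorem constantCoeff_dividedPowSeries (M : ℕ) :
    PowerSeries.constantCoeff (dividedPowSeries M) = 0 := by
  rw [← PowerSeries.coeff_zero_eq_constantCoeff_apply, coeff_dividedPowSeries,
    dividedPow_zero_right]

theorem coeff_zero_one_sub_X_mul (P : PowerSeries ℝ) :
    PowerSeries.coeff 0 ((1 - PowerSeries.X) * P) = PowerSeries.coeff 0 P := by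
  simp [sub_mul]

theorem coeff_succ_one_sub_X_mul (P : PowerSeries ℝ) (n : ℕ) :
    PowerSeries.coeff (n + 1) ((1 - PowerSeries.X) * P) =
      PowerSeries.coeff (n + 1) P - PowerSeries.coeff n P := by
  rw [sub_mul, one_mul, map_sub, PowerSeries.coeff_succ_X_mul]

/-- Dividing by `1 - z` preserves nonnegativity of the coefficients. -/
theorem coeff_nonneg_of_one_sub_X_mul {P : PowerSeries ℝ}
    (h : ∀ n, 0 ≤ PowerSeries.coeff n ((1 - PowerSeries.X) * P)) (n : ℕ) :
    0 ≤ PowerSeries.coeff n P := by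
  induction n with
  | zero => simpa only [coeff_zero_one_sub_X_mul] using h 0
  | succ n ih =>
    have := h (n + 1)
    rw [coeff_succ_one_sub_X_mul] at this
    linarith

theorem coeff_nonneg_of_one_sub_X_pow_mul (k : ℕ) {P : PowerSeries ℝ}
    (h : ∀ n, 0 ≤ PowerSeries.coeff n ((1 - PowerSeries.X) ^ k * P)) (n : ℕ) :
    0 ≤ PowerSeries.coeff n P := by
  induction k with
  | zero => simpa using h n
  | succ k ih =>
    refine ih (coeff_nonneg_of_one_sub_X_mul fun m => ?_)
    rw [← mul_assoc, ← pow_succ']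
    exact h m

theorem one_sub_X_mul_dividedPowSeries_zero :
    (1 - PowerSeries.X) * dividedPowSeries 0 = PowerSeries.X := by
  ext n
  rcases n with _ | _ | n
  · simp [coeff_zero_one_sub_X_mul]
  · rw [coeff_succ_one_sub_X_mul]; simp [dividedPow]
  · rw [coeff_succ_one_sub_X_mul]; simp [dividedPow, PowerSeries.coeff_X]

theorem one_sub_X_mul_dividedPowSeries_one :
    (1 - PowerSeries.X) * dividedPowSeries 1 = dividedPowSeries 0 := by
  ext n
  rcases n with _ | n
  · simp [coeff_zero_one_sub_X_mul]
  · rw [coeff_succ_one_sub_X_mul]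
    simp [dividedPow_succ_left 0, dividedPow_succ]

theorem one_sub_X_mul_dividedPowSeries_two :
    (1 - PowerSeries.X) * dividedPowSeries 2 =
      dividedPowSeries 1 - PowerSeries.C (1 / 2 : ℝ) * dividedPowSeries 0 := by
  ext n
  rcases n with _ | n
  · simp [coeff_zero_one_sub_X_mul]
  · rw [coeff_succ_one_sub_X_mul, map_sub, PowerSeries.coeff_C_mul]
    simp only [coeff_dividedPowSeries, dividedPow_succ, dividedPow_succ_left 1, Nat.factorial]
    push_cast
    ring

theorem one_sub_X_mul_dividedPowSeries_three :
    (1 - PowerSeries.X) * dividedPowSeries 3 =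
      dividedPowSeries 2 - PowerSeries.C (1 / 2 : ℝ) * dividedPowSeries 1 +
        PowerSeries.C (1 / 6 : ℝ) * dividedPowSeries 0 := by
  ext n
  rcases n with _ | n
  · simp [coeff_zero_one_sub_X_mul]
  · rw [coeff_succ_one_sub_X_mul, map_add, map_sub, PowerSeries.coeff_C_mul,
      PowerSeries.coeff_C_mul]
    simp only [coeff_dividedPowSeries, dividedPow_succ, dividedPow_succ_left 2, Nat.factorial]
    push_cast
    ring

/-! ### Coefficientwise inequalities between products of generating functions -/

/-- Chebyshev's integral inequality `∫ u' w' ≤ (∫ u') (∫ w')` on an interval of length one, for `u'`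
increasing and `w'` decreasing, in terms of primitives `u`, `w` of the factors and `Q` of the
product. -/
theorem chebyshev_primitive {u w Q u' w' : ℝ → ℝ} (a : ℝ)
    (hu : ∀ y, HasDerivAt u (u' y) y) (hw : ∀ y, HasDerivAt w (w' y) y)
    (hQ : ∀ y, HasDerivAt Q (u' y * w' y) y)
    (hu' : MonotoneOn u' (Icc a (a + 1))) (hw' : AntitoneOn w' (Icc a (a + 1))) :
    Q (a + 1) - Q a ≤ (u (a + 1) - u a) * (w (a + 1) - w a) := by
  obtain ⟨c, hc, hcu⟩ := exists_hasDerivAt_eq_slope u u' (by linarith : a < a + 1)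
    (fun y _ => (hu y).continuousAt.continuousWithinAt) (fun y _ => hu y)
  have hc' : c ∈ Icc a (a + 1) := Ioo_subset_Icc_self hc
  have hκ : u' c = u (a + 1) - u a := by rw [hcu]; simp
  -- `u' c` is the mean of `u'`, so `(u' - u' c) (w' - w' c) ≤ 0` integrates to the claim.
  let Z : ℝ → ℝ := fun y => Q y - u' c * w y - w' c * (u y - u' c * y)
  have hZ : ∀ y, HasDerivAt Z (u' y * w' y - u' c * w' y - w' c * (u' y - u' c * 1)) y := fun y =>
    ((hQ y).sub ((hw y).const_mul _)).sub
      (((hu y).sub ((hasDerivAt_id y).const_mul _)).const_mul _)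
  have hanti : AntitoneOn Z (Icc a (a + 1)) := by
    refine antitoneOn_of_hasDerivWithinAt_nonpos (convex_Icc _ _)
      (fun y _ => (hZ y).continuousAt.continuousWithinAt) (fun y _ => (hZ y).hasDerivWithinAt)
      fun y hy => ?_
    have hy : y ∈ Icc a (a + 1) := interior_subset hy
    have key : (u' y - u' c) * (w' y - w' c) ≤ 0 := by
      rcases le_total y c with h | h
      · exact mul_nonpos_of_nonpos_of_nonneg (sub_nonpos.2 (hu' hy hc' h))
          (sub_nonneg.2 (hw' hy hc' h))
      · exact mul_nonpos_of_nonneg_of_nonpos (sub_nonneg.2 (hu' hc' hy h))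
          (sub_nonpos.2 (hw' hc' hy h))
    linarith
  have h := hanti (left_mem_Icc.2 (by linarith)) (right_mem_Icc.2 (by linarith))
    (by linarith : a ≤ a + 1)
  simp only [Z] at h
  rw [hκ] at h
  linarith

theorem hasDerivAt_pow_div_factorial (k : ℕ) (y : ℝ) :
    HasDerivAt (fun y : ℝ => y ^ (k + 1) / (k + 1)!) (y ^ k / k !) y := by
  refine ((hasDerivAt_pow (k + 1) y).div_const ((k + 1)! : ℝ)).congr_deriv ?_
  have := Nat.cast_ne_zero (R := ℝ).2 k.factorial_ne_zero
  rw [Nat.factorial_succ, Nat.add_sub_cancel]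
  push_cast
  field_simp

theorem hasDerivAt_sub_pow_div_factorial (k : ℕ) (x y : ℝ) :
    HasDerivAt (fun y : ℝ => (x - y) ^ (k + 1) / (k + 1)!) (-((x - y) ^ k / k !)) y :=
  (hasDerivAt_pow_div_factorial k (x - y)).comp_const_sub x y

/-- A primitive of `y ↦ (y ^ M / M!) ((x - y) ^ K / K!)`, obtained by repeated integration by
parts. -/
noncomputable def betaPrimitive (M K : ℕ) (x y : ℝ) : ℝ :=
  ∑ l ∈ Finset.range (K + 1),
    (y ^ (M + l + 1) / (M + l + 1)!) * ((x - y) ^ (K - l) / (K - l)!)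

theorem betaPrimitive_succ (M K : ℕ) (x y : ℝ) :
    betaPrimitive M (K + 1) x y =
      betaPrimitive (M + 1) K x y + (y ^ (M + 1) / (M + 1)!) * ((x - y) ^ (K + 1) / (K + 1)!) := by
  rw [betaPrimitive, Finset.sum_range_succ', betaPrimitive]
  congr 1
  refine Finset.sum_congr rfl fun l _ => ?_
  rw [show M + (l + 1) + 1 = M + 1 + l + 1 by ring, Nat.add_sub_add_right]

theorem hasDerivAt_betaPrimitive (M K : ℕ) (x y : ℝ) :
    HasDerivAt (betaPrimitive M K x) ((y ^ M / M !) * ((x - y) ^ K / K !)) y := by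
  induction K generalizing M with
  | zero =>
    have : betaPrimitive M 0 x = fun y : ℝ => y ^ (M + 1) / (M + 1)! := by
      ext y; simp [betaPrimitive]
    rw [this]
    simpa using hasDerivAt_pow_div_factorial M y
  | succ K ih =>
    have : betaPrimitive M (K + 1) x = fun y => betaPrimitive (M + 1) K x y +
        (y ^ (M + 1) / (M + 1)!) * ((x - y) ^ (K + 1) / (K + 1)!) :=
      funext fun y => betaPrimitive_succ M K x y
    rw [this]
    refine ((ih (M + 1)).add ((hasDerivAt_pow_div_factorial M y).mul
      (hasDerivAt_sub_pow_div_factorial K x y))).congr_deriv ?_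
    ring

theorem betaPrimitive_zero_right (M K : ℕ) (x : ℝ) : betaPrimitive M K x 0 = 0 := by
  simp [betaPrimitive]

theorem betaPrimitive_self (M K : ℕ) (x : ℝ) :
    betaPrimitive M K x x = x ^ (M + K + 1) / (M + K + 1)! := by
  rw [betaPrimitive, Finset.sum_range_succ, Finset.sum_eq_zero, zero_add]
  · simp
  · intro l hl
    have : K - l ≠ 0 := by have := Finset.mem_range.1 hl; omega
    simp [this]

/-- The discrete form of `∫₀ⁿ (y ^ M / M!) ((n - y) ^ K / K!) dy = n ^ (M + K + 1) / (M + K + 1)!`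
in which integrals over unit intervals are taken factor by factor. -/
theorem pow_div_factorial_le_sum_diff_mul_diff (M K n : ℕ) :
    (n : ℝ) ^ (M + K + 1) / (M + K + 1)! ≤
      ∑ i ∈ Finset.range n,
        (((i : ℝ) + 1) ^ (M + 1) / (M + 1)! - (i : ℝ) ^ (M + 1) / (M + 1)!) *
          (((n : ℝ) - i) ^ (K + 1) / (K + 1)! - ((n : ℝ) - (i + 1)) ^ (K + 1) / (K + 1)!) := by
  have htel := Finset.sum_range_sub (fun i : ℕ => betaPrimitive M K n i) n
  simp only [Nat.cast_zero, betaPrimitive_zero_right, betaPrimitive_self, sub_zero] at htel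
  rw [← htel]
  refine Finset.sum_le_sum fun i hi => ?_
  have hin : (i : ℝ) + 1 ≤ n := by exact_mod_cast Finset.mem_range.1 hi
  have h := chebyshev_primitive (u := fun y : ℝ => y ^ (M + 1) / (M + 1)!)
    (w := fun y : ℝ => -(((n : ℝ) - y) ^ (K + 1) / (K + 1)!)) (Q := betaPrimitive M K n)
    (u' := fun y => y ^ M / M !) (w' := fun y => ((n : ℝ) - y) ^ K / K !) (i : ℝ)
    (hasDerivAt_pow_div_factorial M)
    (fun y => ((hasDerivAt_sub_pow_div_factorial K n y).neg).congr_deriv (neg_neg _))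
    (hasDerivAt_betaPrimitive M K n)
    (fun y hy z _ hyz => by
      have : 0 ≤ y := (Nat.cast_nonneg i).trans hy.1
      dsimp only; gcongr)
    (fun y _ z hz hyz => by
      have : 0 ≤ (n : ℝ) - z := by linarith [hz.2]
      dsimp only; gcongr)
  push_cast
  refine h.trans (le_of_eq ?_)
  ring

theorem coeff_one_sub_X_mul_mul (M K n : ℕ) :
    PowerSeries.coeff (n + 1) (((1 - PowerSeries.X) * dividedPowSeries (M + 1)) *
        ((1 - PowerSeries.X) * dividedPowSeries (K + 1))) =
      ∑ i ∈ Finset.range n,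
        (((i : ℝ) + 1) ^ (M + 1) / (M + 1)! - (i : ℝ) ^ (M + 1) / (M + 1)!) *
          (((n : ℝ) - i) ^ (K + 1) / (K + 1)! - ((n : ℝ) - (i + 1)) ^ (K + 1) / (K + 1)!) := by
  rw [PowerSeries.coeff_mul, Finset.Nat.sum_antidiagonal_succ, coeff_zero_one_sub_X_mul,
    coeff_dividedPowSeries, dividedPow_zero_right, zero_mul, zero_add,
    Finset.Nat.sum_antidiagonal_eq_sum_range_succ_mk, Finset.sum_range_succ]
  simp only [Nat.sub_self, coeff_zero_one_sub_X_mul, coeff_dividedPowSeries, dividedPow_zero_right,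
    mul_zero, add_zero]
  refine Finset.sum_congr rfl fun i hi => ?_
  obtain ⟨d, rfl⟩ := Nat.exists_eq_add_of_lt (Finset.mem_range.1 hi)
  rw [show i + d + 1 - i = d + 1 by omega]
  simp only [coeff_succ_one_sub_X_mul, coeff_dividedPowSeries,
    dividedPow_succ_left]
  push_cast
  congr 3 <;> ring

/-- Coefficientwise `A_M A_K ≥ A_{M+K-1} A_1` for `M, K ≥ 1`. After multiplication by
`(1 - z) ^ 2` the right-hand side is `z A_{M+K-1}`. -/
theorem coeff_mul_one_le (M K n : ℕ) :
    PowerSeries.coeff n (dividedPowSeries (M + K + 1) * dividedPowSeries 1) ≤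
      PowerSeries.coeff n (dividedPowSeries (M + 1) * dividedPowSeries (K + 1)) := by
  rw [← sub_nonneg, ← map_sub]
  refine coeff_nonneg_of_one_sub_X_pow_mul 2 (fun n => ?_) n
  have : (1 - PowerSeries.X) ^ 2 * (dividedPowSeries (M + 1) * dividedPowSeries (K + 1) -
        dividedPowSeries (M + K + 1) * dividedPowSeries 1) =
      ((1 - PowerSeries.X) * dividedPowSeries (M + 1)) *
        ((1 - PowerSeries.X) * dividedPowSeries (K + 1)) -
          PowerSeries.X * dividedPowSeries (M + K + 1) := by
    linear_combination (-dividedPowSeries (M + K + 1)) * ((1 - PowerSeries.X) *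
      one_sub_X_mul_dividedPowSeries_one + one_sub_X_mul_dividedPowSeries_zero)
  rw [this, map_sub, sub_nonneg]
  rcases n with _ | n
  · simp [PowerSeries.coeff_mul]
  · rw [PowerSeries.coeff_succ_X_mul, coeff_one_sub_X_mul_mul, coeff_dividedPowSeries,
      dividedPow_succ_left]
    exact pow_div_factorial_le_sum_diff_mul_diff M K n

/-- Coefficientwise `A_{L+1} A_0 ≤ A_L A_1`: after multiplication by `(1 - z) ^ 2` this is
Bernoulli's inequality `(n + 1) ^ (L + 1) - n ^ (L + 1) ≤ (L + 1) (n + 1) ^ L`. -/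
theorem coeff_mul_zero_le (L n : ℕ) :
    PowerSeries.coeff n (dividedPowSeries (L + 1) * dividedPowSeries 0) ≤
      PowerSeries.coeff n (dividedPowSeries L * dividedPowSeries 1) := by
  rw [← sub_nonneg, ← map_sub]
  refine coeff_nonneg_of_one_sub_X_pow_mul 2 (fun n => ?_) n
  have : (1 - PowerSeries.X) ^ 2 * (dividedPowSeries L * dividedPowSeries 1 -
        dividedPowSeries (L + 1) * dividedPowSeries 0) =
      PowerSeries.X * (dividedPowSeries L - (1 - PowerSeries.X) * dividedPowSeries (L + 1)) := by
    linear_combination (dividedPowSeries L) * ((1 - PowerSeries.X) *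
      one_sub_X_mul_dividedPowSeries_one + one_sub_X_mul_dividedPowSeries_zero) -
      (1 - PowerSeries.X) * dividedPowSeries (L + 1) * one_sub_X_mul_dividedPowSeries_zero
  rw [this]
  rcases n with _ | _ | n
  · simp
  · rw [PowerSeries.coeff_succ_X_mul]; simp
  · rw [PowerSeries.coeff_succ_X_mul, map_sub, coeff_succ_one_sub_X_mul]
    simp only [coeff_dividedPowSeries, dividedPow_succ_left, dividedPow_succ]
    have hB := one_add_mul_le_pow (a := -(1 / ((n : ℝ) + 1))) (by
      have : 1 / ((n : ℝ) + 1) ≤ 1 := by rw [div_le_one (by positivity)]; linarith [n.cast_nonneg (α := ℝ)]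
      linarith) (L + 1)
    have hn : (0 : ℝ) < (n : ℝ) + 1 := by positivity
    have h2 := mul_le_mul_of_nonneg_left hB (pow_pos hn (L + 1)).le
    rw [← mul_pow] at h2
    have e1 : ((n : ℝ) + 1) * (1 + -(1 / ((n : ℝ) + 1))) = n := by field_simp; ring
    have e2 : ((n : ℝ) + 1) ^ (L + 1) * (1 + ((L + 1 : ℕ) : ℝ) * -(1 / ((n : ℝ) + 1))) =
        ((n : ℝ) + 1) ^ (L + 1) - (L + 1) * ((n : ℝ) + 1) ^ L := by
      push_cast; field_simp; ring
    rw [e1, e2] at h2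
    have hf : ((L + 1)! : ℝ) = (L + 1) * L ! := by rw [Nat.factorial_succ]; push_cast; ring
    have hL : (0 : ℝ) < L ! := by positivity
    have e3 : ((n : ℝ) + 1) ^ L / L ! = (L + 1) * ((n : ℝ) + 1) ^ L / (L + 1)! := by
      rw [hf]; field_simp
    push_cast
    rw [e3, sub_nonneg, ← sub_div]
    gcongr
    linarith

/-- Simpson's rule on `[x - 1, x + 1]` overestimates the integral of `y ^ M / M!` for `M ≥ 3`. -/
theorem simpson_pow_div_factorial (M : ℕ) {x : ℝ} (hx : 0 ≤ x) :
    ((x + 1) ^ (M + 4) / (M + 4)! - (x - 1) ^ (M + 4) / (M + 4)!) / 2 ≤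
      ((x + 1) ^ (M + 3) / (M + 3)! + 4 * (x ^ (M + 3) / (M + 3)!) +
        (x - 1) ^ (M + 3) / (M + 3)!) / 6 := by
  let g : ℕ → ℝ → ℝ := fun M x => ((x + 1) ^ (M + 3) / (M + 3)! + 4 * (x ^ (M + 3) / (M + 3)!) +
        (x - 1) ^ (M + 3) / (M + 3)!) / 6 -
      ((x + 1) ^ (M + 4) / (M + 4)! - (x - 1) ^ (M + 4) / (M + 4)!) / 2
  suffices h : ∀ M, ∀ x : ℝ, 0 ≤ x → 0 ≤ g M x from sub_nonneg.1 (h M x hx)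
  have hderiv : ∀ M x, HasDerivAt (g (M + 1)) (g M x) x := by
    intro M x
    have hp : ∀ k (c : ℝ), HasDerivAt (fun x : ℝ => (x + c) ^ (k + 1) / (k + 1)!)
        ((x + c) ^ k / k !) x := fun k c => by
      exact (hasDerivAt_pow_div_factorial k (x + c)).comp_add_const x c
    have := ((((hp (M + 3) 1).add ((hp (M + 3) 0).const_mul 4)).add (hp (M + 3) (-1))).div_const
      6).sub (((hp (M + 4) 1).sub (hp (M + 4) (-1))).div_const 2)
    simpa only [g, add_zero, ← sub_eq_add_neg] using! this
  intro M
  induction M with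
  | zero =>
    intro x _
    refine le_of_eq ?_
    simp only [g, Nat.factorial]
    push_cast
    ring
  | succ M ih =>
    intro x hx
    have h0 : 0 ≤ g (M + 1) 0 := by
      have hf : ((M + 5)! : ℝ) = (M + 5) * (M + 4)! := by rw [Nat.factorial_succ]; push_cast; ring
      have hpos : (0 : ℝ) < (M + 4)! := by positivity
      have e : g (M + 1) 0 = (1 + (-1) ^ M) / (M + 4)! * (1 / 6 - 1 / (2 * ((M : ℝ) + 5))) := by
        simp only [g, show M + 1 + 3 = M + 4 by ring, show M + 1 + 4 = M + 5 by ring, hf]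
        have : (M : ℝ) + 5 ≠ 0 := by positivity
        rw [zero_pow (by omega), zero_add, zero_sub, one_pow, one_pow, pow_add, pow_add]
        field_simp
        ring
      rw [e]
      refine mul_nonneg (div_nonneg ?_ hpos.le) ?_
      · rcases neg_one_pow_eq_or ℝ M with h | h <;> rw [h] <;> norm_num
      · rw [sub_nonneg]
        exact one_div_le_one_div_of_le (by norm_num) (by linarith [M.cast_nonneg (α := ℝ)])
    have hmono : MonotoneOn (g (M + 1)) (Ici 0) :=
      monotoneOn_of_hasDerivWithinAt_nonneg (convex_Ici 0)
        (fun y _ => (hderiv M y).continuousAt.continuousWithinAt)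
        (fun y _ => (hderiv M y).hasDerivWithinAt) fun y hy => ih y (interior_subset hy)
    exact h0.trans (hmono self_mem_Ici hx hx)

/-- Coefficientwise `A_{M+1} A_2 ≤ A_M A_3` for `M ≥ 3`: after multiplication by `(1 - z) ^ 4` this
is Simpson's rule. -/
theorem coeff_mul_two_le (M n : ℕ) :
    PowerSeries.coeff n (dividedPowSeries (M + 4) * dividedPowSeries 2) ≤
      PowerSeries.coeff n (dividedPowSeries (M + 3) * dividedPowSeries 3) := by
  rw [← sub_nonneg, ← map_sub]
  refine coeff_nonneg_of_one_sub_X_pow_mul 4 (fun n => ?_) n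
  have h0 := one_sub_X_mul_dividedPowSeries_zero
  have h1 := one_sub_X_mul_dividedPowSeries_one
  have h2 := one_sub_X_mul_dividedPowSeries_two
  have h3 := one_sub_X_mul_dividedPowSeries_three
  have hc2 : PowerSeries.C (1 / 2 : ℝ) = 3 * PowerSeries.C (1 / 6 : ℝ) := by
    rw [← map_ofNat PowerSeries.C, ← map_mul]; norm_num
  have hc6 : 6 * PowerSeries.C (1 / 6 : ℝ) = 1 := by
    rw [← map_ofNat PowerSeries.C, ← map_mul]; norm_num
  rw [hc2] at h2 h3
  set c := PowerSeries.C (1 / 6 : ℝ) with hc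
  set z := (PowerSeries.X : PowerSeries ℝ)
  have e1 : (1 - z) ^ 2 * dividedPowSeries 1 = z := by
    linear_combination (1 - z) * h1 + h0
  have e2 : (1 - z) ^ 3 * dividedPowSeries 2 = 3 * c * (z + z ^ 2) := by
    linear_combination (1 - z) ^ 2 * h2 + e1 - 3 * c * (1 - z) * h0 - z * hc6
  have e3 : (1 - z) ^ 4 * dividedPowSeries 3 = c * (z + 4 * z ^ 2 + z ^ 3) := by
    linear_combination (1 - z) ^ 3 * h3 + e2 - 3 * c * (1 - z) * e1 + c * (1 - z) ^ 2 * h0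
  have hc4 : PowerSeries.C (2 / 3 : ℝ) = 4 * c := by
    rw [hc, ← map_ofNat PowerSeries.C, ← map_mul]; norm_num
  have : (1 - z) ^ 4 * (dividedPowSeries (M + 3) * dividedPowSeries 3 -
        dividedPowSeries (M + 4) * dividedPowSeries 2) =
      z * (c * dividedPowSeries (M + 3) + z * (PowerSeries.C (2 / 3 : ℝ) * dividedPowSeries (M + 3) +
          z * (c * dividedPowSeries (M + 3))) - (PowerSeries.C (1 / 2 : ℝ) * dividedPowSeries (M + 4) -
            z * (z * (PowerSeries.C (1 / 2 : ℝ) * dividedPowSeries (M + 4))))) := by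
    rw [hc2, hc4]
    linear_combination (dividedPowSeries (M + 3)) * e3 - (1 - z) * dividedPowSeries (M + 4) * e2
  rw [this]
  rcases n with _ | _ | _ | n
  · simp [z]
  · simp [z, hc, PowerSeries.coeff_succ_X_mul]
  · have hf : ((M + 4)! : ℝ) = (M + 4) * (M + 3)! := by rw [Nat.factorial_succ]; push_cast; ring
    have hpos : (0 : ℝ) < (M + 3)! := by positivity
    simp only [z, hc, PowerSeries.coeff_succ_X_mul, PowerSeries.coeff_C_mul, map_add, map_sub,
      coeff_dividedPowSeries, dividedPow_succ_left, PowerSeries.coeff_zero_X_mul, hf]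
    have : 1 / (2 * ((M : ℝ) + 4)) ≤ 1 / 6 :=
      one_div_le_one_div_of_le (by norm_num) (by linarith [M.cast_nonneg (α := ℝ)])
    have h : 0 ≤ (1 / 6 - 1 / (2 * ((M : ℝ) + 4))) / (M + 3)! :=
      div_nonneg (sub_nonneg.2 this) hpos.le
    refine h.trans (le_of_eq ?_)
    simp
    field_simp
  · have h := simpson_pow_div_factorial M (x := (n : ℝ) + 1) (by positivity)
    rw [add_sub_cancel_right] at h
    simp only [z, hc, PowerSeries.coeff_succ_X_mul, PowerSeries.coeff_C_mul, map_add, map_sub,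
      coeff_dividedPowSeries, dividedPow_succ_left]
    push_cast
    rw [show (n : ℝ) + 1 + 1 = n + 2 by ring] at h
    simp only [add_assoc, Nat.reduceAdd]
    linarith

/-! ### Log-concavity of the weights `j / (1 - p ^ j)` -/

/-- The sequence `j / (1 - p ^ j)`, with value `0` at `j = 0`. -/
noncomputable def qWeight (p : ℝ) (j : ℕ) : ℝ := j / (1 - p ^ j)

theorem qWeight_nonneg {p : ℝ} (hp0 : 0 < p) (hp1 : p < 1) (j : ℕ) : 0 ≤ qWeight p j :=
  div_nonneg j.cast_nonneg (sub_nonneg.2 (pow_le_one₀ hp0.le hp1.le))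

theorem qWeight_pos {p : ℝ} (hp0 : 0 < p) (hp1 : p < 1) {j : ℕ} (hj : 0 < j) : 0 < qWeight p j :=
  div_pos (Nat.cast_pos.2 hj) (sub_pos.2 (pow_lt_one₀ hp0.le hp1 hj.ne'))

/-- The inequality between the arithmetic and geometric means of `1, u ^ 2, …, u ^ (2 * k)`,
multiplied by `(k + 1) * (1 - u ^ 2)`. -/
theorem succ_mul_pow_mul_le {u : ℝ} (hu0 : 0 ≤ u) (hu1 : u ≤ 1) (k : ℕ) :
    ((k : ℝ) + 1) * u ^ k * (1 - u ^ 2) ≤ 1 - (u ^ 2) ^ (k + 1) := by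
  induction k with
  | zero => simp
  | succ k ih =>
    have hB := one_add_mul_sub_le_pow (show (-1 : ℝ) ≤ u by linarith) (k + 2)
    have h1 : 0 ≤ 1 - u ^ 2 := by nlinarith
    have h2 := mul_le_mul_of_nonneg_left hB (mul_nonneg (pow_nonneg hu0 k) h1)
    have e1 : (u ^ 2) ^ (k + 1) = u ^ k * u ^ (k + 2) := by ring
    have e2 : (u ^ 2) ^ (k + 1 + 1) = (u ^ 2) ^ (k + 1) * u ^ 2 := by ring
    rw [e2]
    rw [e1] at ih ⊢
    push_cast at h2 ⊢
    have e3 : u ^ (k + 1) = u ^ k * u := pow_succ _ _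
    rw [e3]
    linear_combination ih + h2

theorem sq_mul_pow_mul_le {p : ℝ} (hp0 : 0 < p) (hp1 : p < 1) (k : ℕ) :
    ((k : ℝ) + 1) ^ 2 * p ^ k * (1 - p) ^ 2 ≤ (1 - p ^ (k + 1)) ^ 2 := by
  have hs : √p ^ 2 = p := Real.sq_sqrt hp0.le
  have h := succ_mul_pow_mul_le (Real.sqrt_nonneg p) (Real.sqrt_le_one.2 hp1.le) k
  rw [hs] at h
  have h1 : 0 ≤ ((k : ℝ) + 1) * √p ^ k * (1 - p) := by
    have := sub_nonneg.2 hp1.le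
    positivity
  calc ((k : ℝ) + 1) ^ 2 * p ^ k * (1 - p) ^ 2
      = (((k : ℝ) + 1) * √p ^ k * (1 - p)) ^ 2 := by
        rw [mul_pow, mul_pow, ← pow_mul, mul_comm k 2, pow_mul, hs]
    _ ≤ _ := pow_le_pow_left₀ h1 h 2

/-- With `(1 - p ^ k) (1 - p ^ (k + 2)) = (1 - p ^ (k + 1)) ^ 2 - p ^ k (1 - p) ^ 2`, log-concavity
reduces to `sq_mul_pow_mul_le`. -/
theorem qWeight_log_concave {p : ℝ} (hp0 : 0 < p) (hp1 : p < 1) (k : ℕ) :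
    qWeight p k * qWeight p (k + 2) ≤ qWeight p (k + 1) ^ 2 := by
  rcases k with _ | k
  · simpa [qWeight] using sq_nonneg _
  have hpos : ∀ j : ℕ, 0 < 1 - p ^ (j + 1) := fun j =>
    sub_pos.2 (pow_lt_one₀ hp0.le hp1 j.succ_ne_zero)
  have h := sq_mul_pow_mul_le hp0 hp1 (k + 1)
  rw [qWeight, qWeight, qWeight, div_mul_div_comm, div_pow,
    div_le_div_iff₀ (mul_pos (hpos _) (hpos _)) (pow_pos (hpos _) 2)]
  have e1 : (1 - p ^ (k + 1)) * (1 - p ^ (k + 1 + 2)) =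
      (1 - p ^ (k + 1 + 1)) ^ 2 - p ^ (k + 1) * (1 - p) ^ 2 := by ring
  rw [e1]
  push_cast at h ⊢
  linear_combination h

theorem qWeight_mul_le_step {p : ℝ} (hp0 : 0 < p) (hp1 : p < 1) {i : ℕ} (hi : 0 < i) (d : ℕ) :
    qWeight p i * qWeight p (i + d + 1) ≤ qWeight p (i + 1) * qWeight p (i + d) := by
  induction d with
  | zero => simp [mul_comm]
  | succ d ih =>
    have h1 := qWeight_log_concave hp0 hp1 (i + d)
    have hpos := qWeight_pos hp0 hp1 (show 0 < i + d by omega)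
    refine le_of_mul_le_mul_right ?_ hpos
    have h2 := mul_le_mul_of_nonneg_left h1 (qWeight_nonneg hp0 hp1 i)
    have h3 := mul_le_mul_of_nonneg_right ih (qWeight_nonneg hp0 hp1 (i + d + 1))
    simp only [← add_assoc] at h1 h2 h3 ⊢
    rw [show i + d + 1 + 1 = i + d + 2 by ring]
    linarith

/-- By log-concavity, `qWeight p i * qWeight p j` with `i + j` fixed increases as `i` and `j`
approach each other. -/
theorem qWeight_mul_le {p : ℝ} (hp0 : 0 < p) (hp1 : p < 1) {i j i' j' : ℕ} (hi : 0 < i)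
    (hii : i ≤ i') (hij : i' ≤ j') (hsum : i + j = i' + j') :
    qWeight p i * qWeight p j ≤ qWeight p i' * qWeight p j' := by
  induction i', hii using Nat.le_induction generalizing j' with
  | base => rw [show j = j' by omega]
  | succ i' hii ih =>
    refine (ih (j' := j' + 1) (by omega) (by omega)).trans ?_
    obtain ⟨d, rfl⟩ := Nat.exists_eq_add_of_le (show i' ≤ j' by omega)
    exact qWeight_mul_le_step hp0 hp1 (hi.trans_le hii) d

/-- For `0 < x ≤ x' ≤ y' ≤ y` the quotient `(x^a y^b + x^b y^a) / (x^(a+b) + y^(a+b))`, a function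
of `x / y`, is at most its value at `(x', y')`. -/
theorem pow_add_pow_cross_le {x y x' y' : ℝ} (hx : 0 < x) (hx' : x ≤ x') (hxy' : x' ≤ y')
    (hy : y' ≤ y) (a b : ℕ) :
    (x ^ a * y ^ b + x ^ b * y ^ a) * (x' ^ (a + b) + y' ^ (a + b)) ≤
      (x' ^ a * y' ^ b + x' ^ b * y' ^ a) * (x ^ (a + b) + y ^ (a + b)) := by
  have h0 : 0 < x' := hx.trans_le hx'
  have h1 : 0 < y' := h0.trans_le hxy'
  have hy0 : 0 < y := h1.trans_le hy
  have A : ∀ c : ℕ, 0 ≤ x' ^ c * y ^ c - x ^ c * y' ^ c := fun c => by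
    rw [sub_nonneg]; gcongr
  have B : ∀ c : ℕ, 0 ≤ y ^ c * y' ^ c - x ^ c * x' ^ c := fun c => by
    rw [sub_nonneg]
    gcongr
    exact hx'.trans (hxy'.trans hy)
  have := add_nonneg (mul_nonneg (A a) (B b)) (mul_nonneg (A b) (B a))
  rw [← sub_nonneg]
  refine this.trans (le_of_eq ?_)
  ring

/-! ### A Chebyshev sum inequality for weighted convolutions -/

/-- The symmetrised difference of the coefficients of `A_{S+a} A_{S+b}` and `A_{S+a+b} A_S`. -/
noncomputable def symmDiffTerm (S a b i j : ℕ) : ℝ :=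
  dividedPow (S + a) i * dividedPow (S + b) j + dividedPow (S + b) i * dividedPow (S + a) j -
    (dividedPow (S + a + b) i * dividedPow S j + dividedPow S i * dividedPow (S + a + b) j)

theorem symmDiffTerm_comm (S a b i j : ℕ) : symmDiffTerm S a b i j = symmDiffTerm S a b j i := by
  unfold symmDiffTerm; ring

theorem symmDiffTerm_eq {S a b i j : ℕ} (hi : 0 < i) (hj : 0 < j) :
    symmDiffTerm S a b i j = ((i : ℝ) * j) ^ S *
      ((1 / ((S + a)! * (S + b)!) : ℝ) * ((i : ℝ) ^ a * (j : ℝ) ^ b + (i : ℝ) ^ b * (j : ℝ) ^ a) -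
        (1 / ((S + a + b)! * S !) : ℝ) * ((i : ℝ) ^ (a + b) + (j : ℝ) ^ (a + b))) := by
  simp only [symmDiffTerm, dividedPow, hi.ne', hj.ne', if_false]
  field_simp
  ring

/-- As `i ≤ j` approach each other with `i + j` fixed, `symmDiffTerm` changes sign at most once,
from negative to positive. -/
theorem symmDiffTerm_nonpos {S a b i j i' j' : ℕ} (hi : 0 < i)
    (hii : i ≤ i') (hij : i' ≤ j') (hsum : i + j = i' + j') (h : symmDiffTerm S a b i' j' < 0) :
    symmDiffTerm S a b i j ≤ 0 := by
  have hi' : 0 < i' := by omega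
  have hj' : 0 < j' := by omega
  have hj : 0 < j := by omega
  rw [symmDiffTerm_eq hi' hj'] at h
  rw [symmDiffTerm_eq hi hj]
  have hc := pow_add_pow_cross_le (x := i) (y := j) (x' := i') (y' := j')
    (by exact_mod_cast hi) (by exact_mod_cast hii) (by exact_mod_cast hij)
    (by exact_mod_cast (show j' ≤ j by omega)) a b
  have hc1 : (0 : ℝ) < 1 / ((S + a)! * (S + b)!) := by positivity
  set c1 : ℝ := 1 / ((S + a)! * (S + b)!)
  set c2 : ℝ := 1 / ((S + a + b)! * S !)
  have hF : (0 : ℝ) < (i : ℝ) ^ (a + b) + (j : ℝ) ^ (a + b) := by positivity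
  have hF' : (0 : ℝ) < (i' : ℝ) ^ (a + b) + (j' : ℝ) ^ (a + b) := by positivity
  have h' := neg_of_mul_neg_right h (by positivity)
  refine mul_nonpos_of_nonneg_of_nonpos (by positivity) (le_of_mul_le_mul_right ?_ hF')
  nlinarith [mul_le_mul_of_nonneg_left hc hc1.le, mul_le_mul_of_nonneg_right h'.le hF.le]

/-- Chebyshev's sum inequality for a symmetric nonnegative `g` that increases towards the diagonal
and a symmetric `h` that changes sign at most once, from negative to positive, towards the
diagonal. -/
theorem sum_antidiagonal_mul_nonneg {g h : ℕ → ℕ → ℝ} (N : ℕ) (hg0 : ∀ i j, 0 ≤ g i j)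
    (hg : ∀ i j, g i j = g j i) (hh : ∀ i j, h i j = h j i)
    (hgm : ∀ {i j i' j'}, 0 < i → i ≤ i' → i' ≤ j' → i + j = i' + j' → g i j ≤ g i' j')
    (hhs : ∀ {i j i' j'}, 0 < i → i ≤ i' → i' ≤ j' → i + j = i' + j' → h i' j' < 0 → h i j ≤ 0)
    (hh0 : ∀ j, h 0 j = 0) (hsum : 0 ≤ ∑ ij ∈ Finset.HasAntidiagonal.antidiagonal N, h ij.1 ij.2) :
    0 ≤ ∑ ij ∈ Finset.HasAntidiagonal.antidiagonal N, g ij.1 ij.2 * h ij.1 ij.2 := by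
  -- `γ` is the value of `g` where `h` changes sign, so that `(g - γ) h ≥ 0` everywhere.
  obtain ⟨γ, hγ0, hγ⟩ : ∃ γ : ℝ, 0 ≤ γ ∧ ∀ i j, i ≤ j → i + j = N → γ * h i j ≤ g i j * h i j := by
    classical
    let P : ℕ → Prop := fun i => ∃ j, 0 < i ∧ i ≤ j ∧ i + j = N ∧ h i j < 0
    by_cases hP : ∃ i, P i
    · obtain ⟨k, hk⟩ := hP
      have hkN : k ≤ N := by obtain ⟨j, -, -, hj, -⟩ := hk; omega
      obtain ⟨j₀, hi₀, hij₀, hN₀, hneg⟩ : P (Nat.findGreatest P N) := Nat.findGreatest_spec hkN hk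
      set i₀ := Nat.findGreatest P N
      refine ⟨g i₀ j₀, hg0 _ _, fun i j hij hN => ?_⟩
      rcases Nat.eq_zero_or_pos i with rfl | hi
      · simp [hh0]
      rcases le_or_gt i i₀ with hle | hlt
      · exact mul_le_mul_of_nonpos_right (hgm hi hle hij₀ (by omega))
          (hhs hi hle hij₀ (by omega) hneg)
      · refine mul_le_mul_of_nonneg_right (hgm hi₀ hlt.le hij (by omega)) (not_lt.1 fun hlt' => ?_)
        exact absurd ⟨j, hi, hij, hN, hlt'⟩ (Nat.findGreatest_is_greatest hlt (by omega))
    · refine ⟨0, le_rfl, fun i j hij hN => ?_⟩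
      rw [zero_mul]
      rcases Nat.eq_zero_or_pos i with rfl | hi
      · simp [hh0]
      exact mul_nonneg (hg0 _ _) (not_lt.1 fun hlt => hP ⟨i, j, hi, hij, hN, hlt⟩)
  refine (mul_nonneg hγ0 hsum).trans ?_
  rw [Finset.mul_sum]
  refine Finset.sum_le_sum fun ij hij => ?_
  have hN := Finset.HasAntidiagonal.mem_antidiagonal.1 hij
  rcases le_total ij.1 ij.2 with hle | hle
  · exact hγ _ _ hle hN
  · rw [hg, hh]
    exact hγ _ _ hle (by omega)

/-- A coefficientwise inequality `A_{S+a+b} A_S ≤ A_{S+a} A_{S+b}` persists when the terms of the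
convolutions are weighted by `qWeight p i * qWeight p j`. -/
theorem sum_qWeight_mul_nonneg {p : ℝ} (hp0 : 0 < p) (hp1 : p < 1) (S a b N : ℕ)
    (hcoeff : PowerSeries.coeff N (dividedPowSeries (S + a + b) * dividedPowSeries S) ≤
      PowerSeries.coeff N (dividedPowSeries (S + a) * dividedPowSeries (S + b))) :
    0 ≤ ∑ ij ∈ Finset.HasAntidiagonal.antidiagonal N, qWeight p ij.1 * qWeight p ij.2 *
      (dividedPow (S + a) ij.1 * dividedPow (S + b) ij.2 -
        dividedPow (S + a + b) ij.1 * dividedPow S ij.2) := by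
  have hsymm : ∀ g : ℕ → ℕ → ℝ, (∀ i j, g i j = g j i) →
      ∑ ij ∈ Finset.HasAntidiagonal.antidiagonal N, g ij.1 ij.2 * symmDiffTerm S a b ij.1 ij.2 =
        2 * ∑ ij ∈ Finset.HasAntidiagonal.antidiagonal N, g ij.1 ij.2 *
          (dividedPow (S + a) ij.1 * dividedPow (S + b) ij.2 -
            dividedPow (S + a + b) ij.1 * dividedPow S ij.2) := by
    intro g hg
    rw [two_mul]
    nth_rewrite 2 [← Finset.Nat.sum_antidiagonal_swap]
    rw [← Finset.sum_add_distrib]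
    refine Finset.sum_congr rfl fun ij _ => ?_
    simp only [Prod.fst_swap, Prod.snd_swap, symmDiffTerm]
    rw [hg ij.2 ij.1]
    ring
  have hsum : 0 ≤ ∑ ij ∈ Finset.HasAntidiagonal.antidiagonal N, symmDiffTerm S a b ij.1 ij.2 := by
    have h1 := hsymm (fun _ _ => 1) fun _ _ => rfl
    simp only [one_mul, Finset.sum_sub_distrib] at h1
    simp only [PowerSeries.coeff_mul, coeff_dividedPowSeries] at hcoeff
    rw [h1]
    linarith
  have h := sum_antidiagonal_mul_nonneg (g := fun i j => qWeight p i * qWeight p j) N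
    (fun i j => mul_nonneg (qWeight_nonneg hp0 hp1 i) (qWeight_nonneg hp0 hp1 j))
    (fun i j => mul_comm _ _) (symmDiffTerm_comm S a b) (qWeight_mul_le hp0 hp1)
    symmDiffTerm_nonpos (fun j => by simp [symmDiffTerm]) hsum
  rw [hsymm (fun i j => qWeight p i * qWeight p j) fun i j => mul_comm _ _] at h
  linarith

/-! ### Series in powers of `p ^ x` -/

/-- The sequence `a` grows at most polynomially. -/
def PolynomialGrowth (a : ℕ → ℝ) : Prop :=
  ∃ (C : ℝ) (d : ℕ), ∀ j, |a j| ≤ C * ((j : ℝ) + 1) ^ d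

theorem PolynomialGrowth.nat_mul {a : ℕ → ℝ} (ha : PolynomialGrowth a) :
    PolynomialGrowth fun j => (j : ℝ) * a j := by
  obtain ⟨C, d, h⟩ := ha
  refine ⟨C, d + 1, fun j => ?_⟩
  rw [abs_mul, Nat.abs_cast]
  calc (j : ℝ) * |a j| ≤ ((j : ℝ) + 1) * (C * ((j : ℝ) + 1) ^ d) := by
        gcongr
        · linarith
        · exact h j
    _ = C * ((j : ℝ) + 1) ^ (d + 1) := by ring

theorem PolynomialGrowth.nat_pow_mul {a : ℕ → ℝ} (ha : PolynomialGrowth a) (k : ℕ) :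
    PolynomialGrowth fun j => (j : ℝ) ^ k * a j := by
  induction k with
  | zero => simpa using ha
  | succ k ih => simpa only [pow_succ', mul_assoc] using ih.nat_mul

theorem PolynomialGrowth.const_mul {a : ℕ → ℝ} (ha : PolynomialGrowth a) (c : ℝ) :
    PolynomialGrowth fun j => c * a j := by
  obtain ⟨C, d, h⟩ := ha
  refine ⟨|c| * C, d, fun j => ?_⟩
  rw [abs_mul, mul_assoc]
  exact mul_le_mul_of_nonneg_left (h j) (abs_nonneg c)

theorem PolynomialGrowth.sub {a b : ℕ → ℝ} (ha : PolynomialGrowth a) (hb : PolynomialGrowth b) :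
    PolynomialGrowth fun j => a j - b j := by
  obtain ⟨C, d, h⟩ := ha
  obtain ⟨C', d', h'⟩ := hb
  refine ⟨|C| + |C'|, d + d', fun j => ?_⟩
  have h1 : (1 : ℝ) ≤ (j : ℝ) + 1 := by linarith [j.cast_nonneg (α := ℝ)]
  calc |a j - b j| ≤ |a j| + |b j| := abs_sub _ _
    _ ≤ |C| * ((j : ℝ) + 1) ^ d + |C'| * ((j : ℝ) + 1) ^ d' := by
        gcongr
        · exact (h j).trans (by gcongr; exact le_abs_self C)
        · exact (h' j).trans (by gcongr; exact le_abs_self C')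
    _ ≤ |C| * ((j : ℝ) + 1) ^ (d + d') + |C'| * ((j : ℝ) + 1) ^ (d + d') := by
        gcongr <;> first | exact h1 | omega
    _ = (|C| + |C'|) * ((j : ℝ) + 1) ^ (d + d') := by ring

theorem PolynomialGrowth.convolution {a b : ℕ → ℝ} (ha : PolynomialGrowth a)
    (hb : PolynomialGrowth b) :
    PolynomialGrowth fun n => ∑ ij ∈ Finset.HasAntidiagonal.antidiagonal n, a ij.1 * b ij.2 := by
  obtain ⟨C, d, h⟩ := ha
  obtain ⟨C', d', h'⟩ := hb
  refine ⟨|C| * |C'|, d + d' + 1, fun n => ?_⟩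
  calc |∑ ij ∈ Finset.HasAntidiagonal.antidiagonal n, a ij.1 * b ij.2|
      ≤ ∑ ij ∈ Finset.HasAntidiagonal.antidiagonal n, |a ij.1 * b ij.2| :=
        Finset.abs_sum_le_sum_abs _ _
    _ ≤ ∑ ij ∈ Finset.HasAntidiagonal.antidiagonal n,
          |C| * ((n : ℝ) + 1) ^ d * (|C'| * ((n : ℝ) + 1) ^ d') := by
        refine Finset.sum_le_sum fun ij hij => ?_
        have hn := Finset.HasAntidiagonal.mem_antidiagonal.1 hij
        have h1 : (ij.1 : ℝ) ≤ n := by exact_mod_cast (by omega : ij.1 ≤ n)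
        have h2 : (ij.2 : ℝ) ≤ n := by exact_mod_cast (by omega : ij.2 ≤ n)
        rw [abs_mul]
        gcongr
        · refine (h _).trans ?_
          gcongr
          exact le_abs_self C
        · refine (h' _).trans ?_
          gcongr
          exact le_abs_self C'
    _ = |C| * |C'| * ((n : ℝ) + 1) ^ (d + d' + 1) := by
        rw [Finset.sum_const, Finset.Nat.card_antidiagonal, nsmul_eq_mul]
        push_cast
        ring

theorem PolynomialGrowth.summable {a : ℕ → ℝ} (ha : PolynomialGrowth a) {y : ℝ} (hy0 : 0 < y)
    (hy1 : y < 1) : Summable fun j => ‖a j * y ^ j‖ := by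
  obtain ⟨C, d, h⟩ := ha
  have hs : Summable fun j : ℕ => ((j : ℝ) + 1) ^ d * y ^ (j + 1) := by
    have := (summable_nat_add_iff 1).2
      (summable_pow_mul_geometric_of_norm_lt_one (R := ℝ) d (r := y)
        (by rwa [Real.norm_of_nonneg hy0.le]))
    simpa using this
  refine Summable.of_nonneg_of_le (fun _ => norm_nonneg _) (fun j => ?_) (hs.mul_left (C / y))
  rw [norm_mul, Real.norm_eq_abs, norm_pow, Real.norm_of_nonneg hy0.le]
  calc |a j| * y ^ j ≤ C * ((j : ℝ) + 1) ^ d * y ^ j := by gcongr; exact h j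
    _ = C / y * (((j : ℝ) + 1) ^ d * y ^ (j + 1)) := by field_simp; ring

/-- The Dirichlet-type series `∑_j a_j p ^ (j x)`. -/
noncomputable def expSeries (p : ℝ) (a : ℕ → ℝ) (x : ℝ) : ℝ := ∑' j, a j * (p ^ x) ^ j

theorem PolynomialGrowth.summable_expSeries {a : ℕ → ℝ} (ha : PolynomialGrowth a) {p : ℝ}
    (hp0 : 0 < p) (hp1 : p < 1) {x : ℝ} (hx : 0 < x) :
    Summable fun j => ‖a j * (p ^ x) ^ j‖ :=
  ha.summable (Real.rpow_pos_of_pos hp0 x) (Real.rpow_lt_one hp0.le hp1 hx)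

theorem hasDerivAt_expSeries {p : ℝ} (hp0 : 0 < p) (hp1 : p < 1) {a : ℕ → ℝ}
    {x : ℝ} (ha : PolynomialGrowth a) (hx : 0 < x) :
    HasDerivAt (expSeries p a) (Real.log p * expSeries p (fun j => (j : ℝ) * a j) x) x := by
  have hx2 : 0 < x / 2 := by positivity
  have hderiv : ∀ (j : ℕ) (y : ℝ), HasDerivAt (fun y : ℝ => a j * (p ^ y) ^ j)
      (Real.log p * ((j : ℝ) * a j * (p ^ y) ^ j)) y := by
    intro j y
    have h1 : HasDerivAt (fun y : ℝ => p ^ y) (Real.log p * 1 * p ^ y) y :=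
      (hasDerivAt_id y).const_rpow hp0
    refine ((h1.pow j).const_mul (a j)).congr_deriv ?_
    rcases j with _ | j
    · simp
    · rw [Nat.add_sub_cancel]; ring
  have hsum := (ha.nat_mul.summable_expSeries hp0 hp1 hx2).mul_left |Real.log p|
  have h := hasDerivAt_tsum_of_isPreconnected (t := Ioi (x / 2)) (y₀ := x) (y := x) hsum isOpen_Ioi
    isPreconnected_Ioi (fun j y _ => hderiv j y) (fun j y hy => ?_)
    (show x ∈ Ioi (x / 2) from half_lt_self hx) (ha.summable_expSeries hp0 hp1 hx).of_norm
    (half_lt_self hx)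
  · rw [tsum_mul_left] at h
    exact h
  · have : p ^ y ≤ p ^ (x / 2) := Real.rpow_le_rpow_of_exponent_ge hp0 hp1.le (le_of_lt hy)
    have h0 : 0 ≤ p ^ y := Real.rpow_nonneg hp0.le y
    have h0' : 0 ≤ p ^ (x / 2) := Real.rpow_nonneg hp0.le _
    rw [norm_mul, Real.norm_eq_abs, norm_mul _ ((p ^ y) ^ j), norm_mul _ ((p ^ (x / 2)) ^ j),
      norm_pow, norm_pow, Real.norm_of_nonneg h0, Real.norm_of_nonneg h0']
    gcongr

theorem hasDerivAt_log_pow_mul_expSeries {p : ℝ} (hp0 : 0 < p) (hp1 : p < 1) {a : ℕ → ℝ}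
    {x : ℝ} (ha : PolynomialGrowth a) (k : ℕ) (hx : 0 < x) :
    HasDerivAt (fun x => Real.log p ^ k * expSeries p (fun j => (j : ℝ) ^ k * a j) x)
      (Real.log p ^ (k + 1) * expSeries p (fun j => (j : ℝ) ^ (k + 1) * a j) x) x := by
  refine ((hasDerivAt_expSeries hp0 hp1 (ha.nat_pow_mul k) hx).const_mul _).congr_deriv ?_
  simp only [pow_succ', mul_assoc]
  ring

theorem expSeries_mul {p : ℝ} (hp0 : 0 < p) (hp1 : p < 1) {a b : ℕ → ℝ}
    {x : ℝ} (ha : PolynomialGrowth a) (hb : PolynomialGrowth b) (hx : 0 < x) :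
    expSeries p a x * expSeries p b x =
      expSeries p (fun n => ∑ ij ∈ Finset.HasAntidiagonal.antidiagonal n, a ij.1 * b ij.2) x := by
  rw [expSeries, expSeries, tsum_mul_tsum_eq_tsum_sum_antidiagonal_of_summable_norm
    (ha.summable_expSeries hp0 hp1 hx) (hb.summable_expSeries hp0 hp1 hx), expSeries]
  refine tsum_congr fun n => ?_
  rw [Finset.sum_mul]
  refine Finset.sum_congr rfl fun ij hij => ?_
  rw [← Finset.HasAntidiagonal.mem_antidiagonal.1 hij, pow_add]
  ring

/-- If each `F k` has derivative `F (k + 1)` on `(0, ∞)`, then the iterated derivatives there of a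
function that agrees with `F 0` are the `F k`. -/
theorem iteratedDeriv_eq_of_hasDerivAt {F : ℕ → ℝ → ℝ} {f : ℝ → ℝ}
    (hF : ∀ k x, 0 < x → HasDerivAt (F k) (F (k + 1) x) x) (hf : ∀ x, 0 < x → f x = F 0 x) (k : ℕ)
    {x : ℝ} (hx : 0 < x) : iteratedDeriv k f x = F k x := by
  induction k generalizing x with
  | zero => simpa using hf x hx
  | succ k ih =>
    rw [iteratedDeriv_succ]
    have : iteratedDeriv k f =ᶠ[nhds x] F k :=
      Filter.eventuallyEq_of_mem (Ioi_mem_nhds hx) fun y hy => ih hy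
    rw [this.deriv_eq, (hF k x hx).deriv]

theorem completelyMonotonicOn_of_hasDerivAt {F : ℕ → ℝ → ℝ} {f : ℝ → ℝ}
    (hF : ∀ k x, 0 < x → HasDerivAt (F k) (F (k + 1) x) x) (hf : ∀ x, 0 < x → f x = F 0 x)
    (hsign : ∀ k x, 0 < x → 0 ≤ (-1) ^ k * F k x) : CompletelyMonotonicOn f (Ioi 0) := by
  have h : ∀ k, EqOn (iteratedDerivWithin k f (Ioi 0)) (F k) (Ioi 0) := fun k x hx => by
    rw [iteratedDerivWithin_of_isOpen isOpen_Ioi hx]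
    exact iteratedDeriv_eq_of_hasDerivAt hF hf k hx
  refine ⟨contDiffOn_of_differentiableOn_deriv fun k _ => ?_, fun k x hx => ?_⟩
  · exact DifferentiableOn.congr
      (fun x hx => (hF k x hx).differentiableAt.differentiableWithinAt) (h k)
  · rw [h k hx]
    exact hsign k x hx

/-- A series `∑_j c_j p ^ (j x)` with nonnegative coefficients is completely monotonic. -/
theorem completelyMonotonicOn_of_eq_expSeries {p : ℝ} (hp0 : 0 < p) (hp1 : p < 1) {c : ℕ → ℝ}
    (hc : PolynomialGrowth c) (hc0 : ∀ j, 0 ≤ c j) {f : ℝ → ℝ}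
    (hf : ∀ x, 0 < x → f x = expSeries p c x) : CompletelyMonotonicOn f (Ioi 0) := by
  refine completelyMonotonicOn_of_hasDerivAt
    (F := fun k x => Real.log p ^ k * expSeries p (fun j => (j : ℝ) ^ k * c j) x)
    (fun k x hx => hasDerivAt_log_pow_mul_expSeries hp0 hp1 hc k hx)
    (fun x hx => by simpa using hf x hx) fun k x _ => ?_
  rw [← mul_assoc, ← mul_pow]
  refine mul_nonneg (pow_nonneg ?_ k) (tsum_nonneg fun j => ?_)
  · linarith [Real.log_neg hp0 hp1]
  · exact mul_nonneg (mul_nonneg (pow_nonneg j.cast_nonneg k) (hc0 j))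
      (pow_nonneg (Real.rpow_nonneg hp0.le x) j)

/-! ### Series expansion of the `q`-polygamma functions -/

/-- The coefficients `1 / (j (1 - p ^ j))` of `-∑_k log (1 - p ^ (k + x))` as a power series in
`p ^ x`, with value `0` at `j = 0`. -/
noncomputable def logCoeff (p : ℝ) (j : ℕ) : ℝ := (1 - p ^ j)⁻¹ / j

theorem logCoeff_nonneg {p : ℝ} (hp0 : 0 < p) (hp1 : p < 1) (j : ℕ) : 0 ≤ logCoeff p j :=
  div_nonneg (inv_nonneg.2 (sub_nonneg.2 (pow_le_one₀ hp0.le hp1.le))) j.cast_nonneg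

theorem polynomialGrowth_logCoeff {p : ℝ} (hp0 : 0 < p) (hp1 : p < 1) :
    PolynomialGrowth (logCoeff p) := by
  refine ⟨(1 - p)⁻¹, 0, fun j => ?_⟩
  have hp : 0 < 1 - p := sub_pos.2 hp1
  rw [pow_zero, mul_one, abs_of_nonneg (logCoeff_nonneg hp0 hp1 j)]
  rcases j with _ | j
  · simpa [logCoeff] using hp.le
  · have h1 : p ^ (j + 1) ≤ p := pow_le_of_le_one hp0.le hp1.le j.succ_ne_zero
    have h2 : (1 - p ^ (j + 1))⁻¹ ≤ (1 - p)⁻¹ := inv_anti₀ hp (by linarith)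
    refine (div_le_self (inv_nonneg.2 (by linarith)) ?_).trans h2
    push_cast
    linarith [j.cast_nonneg (α := ℝ)]

/-- Since `0 ^ (M + 1) = 0`, the identity also holds at `j = 0`. -/
theorem pow_mul_logCoeff (p : ℝ) (M j : ℕ) :
    (j : ℝ) ^ (M + 2) * logCoeff p j = M ! * (qWeight p j * dividedPow M j) := by
  rcases j with _ | j
  · simp
  · have hM := Nat.cast_ne_zero (R := ℝ).2 M.factorial_ne_zero
    have hj : (j : ℝ) + 1 ≠ 0 := by positivity
    rw [logCoeff, qWeight, dividedPow_succ]
    push_cast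
    field_simp
    ring

/-- Expand the logarithms and sum the resulting geometric series over `k` first. -/
theorem hasSum_neg_log_one_sub_rpow {p : ℝ} (hp0 : 0 < p) (hp1 : p < 1) {x : ℝ} (hx : 0 < x) :
    HasSum (fun k : ℕ => -Real.log (1 - p ^ ((k : ℝ) + x))) (expSeries p (logCoeff p) x) := by
  have hterms := (polynomialGrowth_logCoeff hp0 hp1).summable_expSeries hp0 hp1 hx
  have hexp : expSeries p (logCoeff p) x = ∑' j, logCoeff p j * (p ^ x) ^ j := rfl
  have hy0 : 0 < p ^ x := Real.rpow_pos_of_pos hp0 x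
  have hy1 : p ^ x < 1 := Real.rpow_lt_one hp0.le hp1 hx
  have hpow : ∀ k : ℕ, p ^ ((k : ℝ) + x) = p ^ k * p ^ x := fun k => by
    rw [Real.rpow_add hp0, Real.rpow_natCast]
  simp only [hpow]
  generalize p ^ x = y at *
  let f : ℕ × ℕ → ℝ := fun jk => (p ^ jk.2 * y) ^ (jk.1 + 1) / ((jk.1 : ℝ) + 1)
  have hrow : ∀ j : ℕ, HasSum (fun k => f (j, k)) (logCoeff p (j + 1) * y ^ (j + 1)) := by
    intro j
    have h := (hasSum_geometric_of_lt_one (pow_nonneg hp0.le (j + 1))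
      (pow_lt_one₀ hp0.le hp1 j.succ_ne_zero)).mul_left (y ^ (j + 1) / ((j : ℝ) + 1))
    rw [show logCoeff p (j + 1) * y ^ (j + 1) =
      y ^ (j + 1) / ((j : ℝ) + 1) * (1 - p ^ (j + 1))⁻¹ by rw [logCoeff]; push_cast; ring]
    refine h.congr_fun fun k => ?_
    simp only [f]
    rw [mul_pow, ← pow_mul, ← pow_mul, mul_comm k]
    ring
  have hsum : Summable f := by
    refine (summable_prod_of_nonneg fun jk => by positivity).2 ⟨fun j => (hrow j).summable, ?_⟩
    simp only [(hrow _).tsum_eq]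
    exact (summable_nat_add_iff 1).2 hterms.of_norm
  have htot : HasSum f (expSeries p (logCoeff p) x) := by
    have h1 := hsum.hasSum.prod_fiberwise hrow
    have h2 := (hasSum_nat_add_iff' 1).2 hterms.of_norm.hasSum
    have h3 : expSeries p (logCoeff p) x = ∑' jk, f jk := by
      refine Eq.trans ?_ (h2.unique h1)
      simp [hexp, logCoeff]
    rw [h3]
    exact hsum.hasSum
  have hswap : HasSum (f ∘ Prod.swap) (expSeries p (logCoeff p) x) :=
    (Equiv.prodComm ℕ ℕ).hasSum_iff.2 htot
  refine hswap.prod_fiberwise fun k => ?_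
  have hk0 : 0 < p ^ k * y := by positivity
  have hk1 : p ^ k * y < 1 :=
    (mul_le_of_le_one_left hy0.le (pow_le_one₀ hp0.le hp1.le)).trans_lt hy1
  have h := Real.hasSum_pow_div_log_of_abs_lt_one (x := p ^ k * y) (by rwa [abs_of_pos hk0])
  simpa only [f, Function.comp_apply, Prod.swap_prod_mk] using h

theorem tprod_qGamma_eq_exp {p : ℝ} (hp0 : 0 < p) (hp1 : p < 1) {x : ℝ} (hx : 0 < x) :
    ∏' k : ℕ, (1 - p ^ ((k : ℝ) + 1)) / (1 - p ^ ((k : ℝ) + x)) =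
      Real.exp (expSeries p (logCoeff p) x - expSeries p (logCoeff p) 1) := by
  have hpos : ∀ y : ℝ, 0 < y → ∀ k : ℕ, 0 < 1 - p ^ ((k : ℝ) + y) := fun y hy k =>
    sub_pos.2 (Real.rpow_lt_one hp0.le hp1 (by positivity))
  have h : HasSum (fun k : ℕ => Real.log ((1 - p ^ ((k : ℝ) + 1)) / (1 - p ^ ((k : ℝ) + x))))
      (expSeries p (logCoeff p) x - expSeries p (logCoeff p) 1) := by
    refine ((hasSum_neg_log_one_sub_rpow hp0 hp1 hx).sub
      (hasSum_neg_log_one_sub_rpow hp0 hp1 one_pos)).congr_fun ?_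
    intro k
    rw [Real.log_div (hpos 1 one_pos k).ne' (hpos x hx k).ne']
    ring
  rw [← Real.rexp_tsum_eq_tprod (fun k => div_pos (hpos 1 one_pos k) (hpos x hx k)) h.summable,
    h.tsum_eq]

theorem qGamma_eq_exp_of_lt_one {q : ℝ} (hq0 : 0 < q) (hq1 : q < 1) {x : ℝ} (hx : 0 < x) :
    qGamma q x = Real.exp (Real.log (1 - q) * (1 - x) +
      (expSeries q (logCoeff q) x - expSeries q (logCoeff q) 1)) := by
  rw [qGamma, if_pos hq1, tprod_qGamma_eq_exp hq0 hq1 hx, Real.exp_add,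
    ← Real.rpow_def_of_pos (sub_pos.2 hq1)]

theorem qGamma_eq_exp_of_one_lt {q : ℝ} (hq1 : 1 < q) {x : ℝ} (hx : 0 < x) :
    qGamma q x = Real.exp (Real.log (q - 1) * (1 - x) + Real.log q * (1 / 2 * x * (x - 1)) +
      (expSeries q⁻¹ (logCoeff q⁻¹) x - expSeries q⁻¹ (logCoeff q⁻¹) 1)) := by
  have hq0 : 0 < q := one_pos.trans hq1
  have hinv : ∀ y : ℝ, q ^ (-y) = q⁻¹ ^ y := fun y => by
    rw [Real.rpow_neg hq0.le, Real.inv_rpow hq0.le]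
  rw [qGamma, if_neg hq1.not_gt]
  simp only [hinv]
  rw [tprod_qGamma_eq_exp (inv_pos.2 hq0) (inv_lt_one_of_one_lt₀ hq1) hx, Real.exp_add,
    Real.exp_add, ← Real.rpow_def_of_pos (sub_pos.2 hq1), ← Real.rpow_def_of_pos hq0]

/-- The derivatives of the logarithmic derivative of `exp (quadratic + ∑_j p ^ (j x) logCoeff p j)`.
The quadratic contributes to the first of them through its leading coefficient, and to none of the
later ones. -/
theorem iteratedDeriv_logDeriv_eq {p : ℝ} (hp0 : 0 < p) (hp1 : p < 1) {G : ℝ → ℝ} (c₀ c₁ c₂ : ℝ)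
    (hG : ∀ x, 0 < x → G x = Real.exp (c₀ + c₁ * x + c₂ * x ^ 2 + expSeries p (logCoeff p) x))
    {m : ℕ} (hm : 1 < m ∨ 0 < m ∧ c₂ = 0) {x : ℝ} (hx : 0 < x) :
    iteratedDeriv m (logDeriv G) x =
      Real.log p ^ (m + 1) * expSeries p (fun j => (j : ℝ) ^ (m + 1) * logCoeff p j) x := by
  have hgr := polynomialGrowth_logCoeff hp0 hp1
  let P : ℕ → ℝ → ℝ := fun k x =>
    match k with
    | 0 => c₁ + 2 * c₂ * x
    | 1 => 2 * c₂
    | _ + 2 => 0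
  let F : ℕ → ℝ → ℝ := fun k x => P k x +
    Real.log p ^ (k + 1) * expSeries p (fun j => (j : ℝ) ^ (k + 1) * logCoeff p j) x
  have hP : ∀ k x, HasDerivAt (P k) (P (k + 1) x) x := by
    intro k x
    match k with
    | 0 => simpa [P] using! ((hasDerivAt_id x).const_mul (2 * c₂)).const_add c₁
    | 1 => exact hasDerivAt_const x _
    | k + 2 => exact hasDerivAt_const x _
  have hF : ∀ k x, 0 < x → HasDerivAt (F k) (F (k + 1) x) x := fun k x hx =>
    (hP k x).add (hasDerivAt_log_pow_mul_expSeries hp0 hp1 hgr (k + 1) hx)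
  have hlog : ∀ x, 0 < x → logDeriv G x = F 0 x := by
    intro x hx
    have hGx : G =ᶠ[nhds x] fun x =>
        Real.exp (c₀ + c₁ * x + c₂ * x ^ 2 + expSeries p (logCoeff p) x) :=
      Filter.eventuallyEq_of_mem (Ioi_mem_nhds hx) fun y hy => hG y hy
    have hD : HasDerivAt (fun x => c₀ + c₁ * x + c₂ * x ^ 2 + expSeries p (logCoeff p) x)
        (F 0 x) x := by
      have h1 := hasDerivAt_expSeries hp0 hp1 hgr hx
      have h2 := ((((hasDerivAt_id x).const_mul c₁).const_add c₀).add
        ((hasDerivAt_pow 2 x).const_mul c₂)).add h1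
      refine h2.congr_deriv ?_
      simp [F, P]
      ring
    rw [logDeriv_apply, hGx.deriv_eq, hD.exp.deriv, hG x hx,
      mul_div_cancel_left₀ _ (Real.exp_ne_zero _)]
  rw [iteratedDeriv_eq_of_hasDerivAt hF hlog m hx]
  have hPm : P m x = 0 := by
    match m, hm with
    | 0, hm => omega
    | 1, hm =>
      have : c₂ = 0 := by simpa using hm
      simp [P, this]
    | m + 2, _ => rfl
  simp [F, hPm]

/-- The series for `ψ_q^{(m)}` in powers of `p ^ x`, where `p = q` or `p = q⁻¹`. For `q > 1` the
factor `q ^ (x (x - 1) / 2)` of `Γ_q` adds `log q` to `ψ_q'`, so that `m = 1` is excluded. -/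
theorem exists_qPolygamma_eq {q : ℝ} (hq : 0 < q) (hq1 : q ≠ 1) :
    ∃ p : ℝ, 0 < p ∧ p < 1 ∧ ∀ m : ℕ, (1 < m ∨ 0 < m ∧ q < 1) → ∀ x : ℝ, 0 < x →
      qPolygamma q m x =
        Real.log p ^ (m + 1) * expSeries p (fun j => (j : ℝ) ^ (m + 1) * logCoeff p j) x := by
  rcases hq1.lt_or_gt with h | h
  · refine ⟨q, hq, h, fun m hm x hx => ?_⟩
    refine iteratedDeriv_logDeriv_eq hq h (Real.log (1 - q) - expSeries q (logCoeff q) 1)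
      (-Real.log (1 - q)) 0 (fun y hy => ?_) (hm.imp_right fun h => ⟨h.1, rfl⟩) hx
    rw [qGamma_eq_exp_of_lt_one hq h hy]
    congr 1
    ring
  · refine ⟨q⁻¹, inv_pos.2 hq, inv_lt_one_of_one_lt₀ h, fun m hm x hx => ?_⟩
    refine iteratedDeriv_logDeriv_eq (inv_pos.2 hq) (inv_lt_one_of_one_lt₀ h)
      (Real.log (q - 1) - expSeries q⁻¹ (logCoeff q⁻¹) 1)
      (-Real.log (q - 1) - Real.log q / 2) (Real.log q / 2) (fun y hy => ?_)
      (Or.inl (hm.resolve_right fun h' => lt_asymm h h'.2)) hx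
    rw [qGamma_eq_exp_of_one_lt h hy]
    congr 1
    ring

/-! ### Complete monotonicity -/

/-- The cases `s = 1`, `s = 2` and `s = 3`, `n = 4`, in the form `s = S + 1`, `m = S + a + 1`,
`n = S + b + 1`. -/
theorem coeff_dividedPowSeries_mul_le {S a b : ℕ} (h : S = 0 ∨ S = 1 ∨ S = 2 ∧ b = 1 ∧ 1 ≤ a)
    (N : ℕ) :
    PowerSeries.coeff N (dividedPowSeries (S + a + b) * dividedPowSeries S) ≤
      PowerSeries.coeff N (dividedPowSeries (S + a) * dividedPowSeries (S + b)) := by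
  have h1 := coeff_mul_one_le a b N
  rcases h with rfl | rfl | ⟨rfl, rfl, ha⟩
  · rcases a with _ | a
    · simp [mul_comm]
    rcases b with _ | b
    · simp
    simp only [zero_add, show a + 1 + (b + 1) = a + b + 1 + 1 by ring]
    exact (coeff_mul_zero_le _ N).trans (coeff_mul_one_le a b N)
  · rw [show 1 + a + b = a + b + 1 by ring, add_comm 1 a, add_comm 1 b]
    exact h1
  · obtain ⟨a, rfl⟩ := Nat.exists_eq_add_of_le ha
    rw [show 2 + (1 + a) + 1 = a + 4 by ring, show 2 + (1 + a) = a + 3 by ring]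
    exact coeff_mul_two_le a N

theorem corollary2 (q : ℝ) (hq : 0 < q) (hq1 : q ≠ 1) (r m n s : ℕ)
    (hs : 0 < s) (hsn : s ≤ n) (hnm : n ≤ m) (hmr : m ≤ r) (hsum : r + s = m + n)
    (hcase : (q < 1 ∧ s = 1) ∨ s = 2 ∨ (s = 3 ∧ n = 4)) :
    CompletelyMonotonicOn
      (fun x : ℝ =>
        (-1) ^ (m + n) * qPolygamma q m x * qPolygamma q n x -
          alphaCoeff r m n s * (-1) ^ (r + s) * qPolygamma q r x * qPolygamma q s x)
      (Ioi 0) := by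
  obtain ⟨p, hp0, hp1, hψ⟩ := exists_qPolygamma_eq hq hq1
  obtain ⟨S, rfl⟩ := Nat.exists_eq_add_of_lt hs
  obtain ⟨a, rfl⟩ := Nat.exists_eq_add_of_le (hsn.trans hnm)
  obtain ⟨b, rfl⟩ := Nat.exists_eq_add_of_le hsn
  obtain rfl : r = S + a + b + 1 := by omega
  rw [show 0 + S + 1 + a = S + a + 1 by ring, show 0 + S + 1 + b = S + b + 1 by ring,
    show 0 + S + 1 = S + 1 by ring] at *
  -- For `q > 1` all four orders are at least `2`, where the series for `ψ_q^{(k)}` has no extra term.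
  have hind : ∀ k, S ≤ k → 1 < k + 1 ∨ 0 < k + 1 ∧ q < 1 := fun k hk => by
    rcases hcase with h | h | h
    · exact Or.inr ⟨k.succ_pos, h.1⟩
    all_goals exact Or.inl (by omega)
  let A : ℕ → ℕ → ℝ := fun k j => (j : ℝ) ^ (k + 2) * logCoeff p j
  have hA : ∀ k, PolynomialGrowth (A k) := fun k =>
    (polynomialGrowth_logCoeff hp0 hp1).nat_pow_mul (k + 2)
  let α := alphaCoeff (S + a + b + 1) (S + a + 1) (S + b + 1) (S + 1)
  let c : ℕ → ℝ := fun N => Real.log p ^ 2 * (-Real.log p) ^ (S + a + 1 + (S + b + 1)) *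
    (∑ ij ∈ Finset.HasAntidiagonal.antidiagonal N, A (S + a) ij.1 * A (S + b) ij.2 -
      α * ∑ ij ∈ Finset.HasAntidiagonal.antidiagonal N, A (S + a + b) ij.1 * A S ij.2)
  have hconv : ∀ k l, PolynomialGrowth fun N =>
      ∑ ij ∈ Finset.HasAntidiagonal.antidiagonal N, A k ij.1 * A l ij.2 :=
    fun k l => (hA k).convolution (hA l)
  refine completelyMonotonicOn_of_eq_expSeries hp0 hp1 (c := c)
    (((hconv _ _).sub ((hconv _ _).const_mul α)).const_mul _) (fun N => ?_) fun x hx => ?_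
  · have hL : 0 < -Real.log p := neg_pos.2 (Real.log_neg hp0 hp1)
    refine mul_nonneg (mul_nonneg (sq_nonneg _) (pow_nonneg hL.le _)) ?_
    have h := sum_qWeight_mul_nonneg hp0 hp1 S a b N
      (coeff_dividedPowSeries_mul_le (by omega) N)
    have hpos : (0 : ℝ) ≤ (S + a)! * (S + b)! := by positivity
    refine (mul_nonneg hpos h).trans (le_of_eq ?_)
    rw [Finset.mul_sum, Finset.mul_sum, ← Finset.sum_sub_distrib]
    refine Finset.sum_congr rfl fun ij _ => ?_
    have h1 : ((S + a + b)! : ℝ) ≠ 0 := by positivity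
    have h2 : (S ! : ℝ) ≠ 0 := by positivity
    simp only [A, α, pow_mul_logCoeff, alphaCoeff, Nat.add_sub_cancel]
    field_simp
  · have hmul := fun k l => expSeries_mul hp0 hp1 (hA k) (hA l) hx
    have hsumm := fun k l => ((hconv k l).summable_expSeries hp0 hp1 hx).of_norm
    have hc : expSeries p c x = Real.log p ^ 2 * (-Real.log p) ^ (S + a + 1 + (S + b + 1)) *
        (expSeries p (A (S + a)) x * expSeries p (A (S + b)) x -
          α * (expSeries p (A (S + a + b)) x * expSeries p (A S) x)) := by
      rw [hmul, hmul, expSeries, expSeries, expSeries, ← tsum_mul_left,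
        ← (hsumm _ _).tsum_sub ((hsumm _ _).mul_left α), ← tsum_mul_left]
      refine tsum_congr fun N => ?_
      simp only [c]
      ring
    rw [hc, hψ _ (hind _ (by omega)) x hx, hψ _ (hind _ (by omega)) x hx,
      hψ _ (hind _ (by omega)) x hx, hψ _ (hind _ le_rfl) x hx, neg_pow (Real.log p)]
    simp only [A, α]
    ring
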